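/- Let $\Omega\subset\mathbb R^2$ be a bounded connected open set. Let $1<p<+\infty$ and put $p^*:=\frac{2p}{2-p}$ if $p<2$ and $p^*:=+\infty$ if $p\ge 2$. For an open set $A\subset\Omega$ let $W_0^{1,p}(A)$ be the closure of $C_c^\infty(A)$ in the Sobolev space $W^{1,p}(A)$ of real-valued functions, and, for $1<q<p^*$, define the Poincaré–Sobolev constant $$C_{p,q}(A):=\sup_{u\in W_0^{1,p}(A),\ u\neq 0}\frac{\left(\int_A |u(x)|^q\,dx\right)^{p/q}}{\int_A|\nabla u(x)|^p\,dx}\in[0,+\infty],$$ with $C_{p,q}(\emptyset):=0$. Lemma (Maxitivity of Poincaré–Sobolev constants). Let $1<p\le q<p^*$. If $A_1,A_2\subset\Omega$ are open sets with $A_1\cap A_2=\emptyset$, then $$C_{p,q}(A_1\cup A_2)=\max\{C_{p,q}(A_1),\,C_{p,q}(A_2)\}.$$ -/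

import Mathlib

open MeasureTheory TopologicalSpace Filter
open scoped Topology ENNReal Distributions

noncomputable section

/-- The Euclidean plane `ℝ²`. -/
abbrev Plane : Type := EuclideanSpace ℝ (Fin 2)

/-- The Sobolev conjugate exponent of `p` in dimension two:
`p* = 2p / (2 - p)` if `p < 2`, and `p* = +∞` if `p ≥ 2`. -/
def sobolevConjugate (p : ℝ) : ℝ≥0∞ :=
  if p < 2 then ENNReal.ofReal (2 * p / (2 - p)) else ⊤

/-- `g` is a weak gradient of `u` on the open set `A`: both are locally integrable on `A` and
`∫_A u ∂ᵢφ = - ∫_A gᵢ φ` for every `φ ∈ C_c^∞(A)` and `i = 1, 2`. -/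
structure IsWeakGradient (A : Opens Plane) (u : Plane → ℝ) (g : Plane → Plane) : Prop where
  locallyIntegrableOn_fun : LocallyIntegrableOn u (A : Set Plane)
  locallyIntegrableOn_grad : LocallyIntegrableOn g (A : Set Plane)
  integral_eq : ∀ (φ : 𝓓(A, ℝ)) (i : Fin 2),
    ∫ x in (A : Set Plane), u x * (gradient (φ : Plane → ℝ) x) i =
      - ∫ x in (A : Set Plane), (g x) i * φ x

/-- `u` belongs to `W^{1,p}(A)`, with weak gradient `g`. Only the values of `u` and `g` on `A`,
up to null sets, are relevant. -/
structure MemW1p (A : Opens Plane) (p : ℝ) (u : Plane → ℝ) (g : Plane → Plane) : Prop where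
  memLp_fun : MemLp u (ENNReal.ofReal p) (volume.restrict (A : Set Plane))
  memLp_grad : MemLp g (ENNReal.ofReal p) (volume.restrict (A : Set Plane))
  isWeakGradient : IsWeakGradient A u g

/-- `u` belongs to `W_0^{1,p}(A)`, the closure of `C_c^∞(A)` in `W^{1,p}(A)`, and `g` is its
weak gradient. -/
structure MemW01p (A : Opens Plane) (p : ℝ) (u : Plane → ℝ) (g : Plane → Plane) : Prop where
  memW1p : MemW1p A p u g
  exists_approx : ∃ φ : ℕ → 𝓓(A, ℝ),
    Tendsto (fun n => eLpNorm (fun x => φ n x - u x) (ENNReal.ofReal p)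
      (volume.restrict (A : Set Plane))) atTop (𝓝 0) ∧
    Tendsto (fun n => eLpNorm (fun x => gradient (φ n : Plane → ℝ) x - g x) (ENNReal.ofReal p)
      (volume.restrict (A : Set Plane))) atTop (𝓝 0)

/-- The Poincaré–Sobolev constant `C_{p,q}(A)`: the supremum in `[0, +∞]` of
`(∫_A |u|^q)^{p/q} / ∫_A |∇u|^p` over all nonzero `u ∈ W_0^{1,p}(A)`
(so it is `0` if `A` is empty). -/
def poincareSobolev (p q : ℝ) (A : Opens Plane) : ℝ≥0∞ :=
  ⨆ (u : Plane → ℝ) (g : Plane → Plane) (_ : MemW01p A p u g)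
    (_ : ¬ u =ᵐ[volume.restrict (A : Set Plane)] 0),
    (∫⁻ x in (A : Set Plane), ‖u x‖ₑ ^ q) ^ (p / q) / ∫⁻ x in (A : Set Plane), ‖g x‖ₑ ^ p

end

/-! For disjoint open sets, `W_0^{1,p}` of the union splits into the two pieces: cutting a test
function off to one piece keeps it smooth and compactly supported there
(`tsupport_indicator_subset`). Extension by zero preserves both integrals, which gives `≥`. For `≤`,
let `M` be the maximum and `aᵢ` the integral of `|u|^q` over the `i`-th piece. As `p/q ≤ 1`, `(a₁ +
a₂)^(p/q) ≤ a₁^(p/q) + a₂^(p/q)`; each term is at most `M` times the gradient integral over its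
piece, and these integrals add up. -/

noncomputable section

namespace TestFunction

variable {A B : Opens Plane}

/-- A test function on `A` is a test function on every larger open set. -/
def extend (h : A ≤ B) (φ : 𝓓(A, ℝ)) : 𝓓(B, ℝ) :=
  ⟨φ, φ.contDiff, φ.hasCompactSupport, φ.tsupport_subset.trans h⟩

lemma coe_extend (h : A ≤ B) (φ : 𝓓(A, ℝ)) : (φ.extend h : Plane → ℝ) = φ := rfl

lemma eventuallyEq_zero_of_notMem (φ : 𝓓(A, ℝ)) {x : Plane} (hx : x ∉ A) :
    (φ : Plane → ℝ) =ᶠ[𝓝 x] fun _ => 0 :=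
  notMem_tsupport_iff_eventuallyEq.1 fun h => hx (φ.tsupport_subset h)

lemma gradient_eq_zero_of_notMem (φ : 𝓓(A, ℝ)) {x : Plane} (hx : x ∉ A) :
    gradient (φ : Plane → ℝ) x = 0 := by
  rw [(φ.eventuallyEq_zero_of_notMem hx).gradient_eq, gradient_fun_const]

lemma apply_eq_zero_of_notMem (φ : 𝓓(A, ℝ)) {x : Plane} (hx : x ∉ A) : φ x = 0 :=
  (φ.eventuallyEq_zero_of_notMem hx).eq_of_nhds

/-- The support lies in `A ∪ B` and in the closure of `A`, which misses `B` because `B` is open and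
disjoint from `A`. -/
lemma tsupport_indicator_subset (hAB : Disjoint (A : Set Plane) B) (φ : 𝓓(A ⊔ B, ℝ)) :
    tsupport ((A : Set Plane).indicator φ) ⊆ A := by
  intro x hx
  have h₁ : tsupport ((A : Set Plane).indicator φ) ⊆ tsupport φ :=
    closure_mono (by rw [Set.support_indicator]; exact Set.inter_subset_right)
  have h₂ : tsupport ((A : Set Plane).indicator φ) ⊆ closure A :=
    closure_mono Set.support_indicator_subset
  rcases φ.tsupport_subset (h₁ hx) with h | h
  · exact h
  · exact absurd h ((hAB.closure_left B.isOpen).notMem_of_mem_left (h₂ hx))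

/-- The restriction to `A` of a test function on the disjoint union of `A` and `B`. -/
def restrictLeft (hAB : Disjoint (A : Set Plane) B) (φ : 𝓓(A ⊔ B, ℝ)) : 𝓓(A, ℝ) where
  toFun := (A : Set Plane).indicator φ
  contDiff' := by
    rw [contDiff_iff_contDiffAt]
    intro x
    by_cases hx : x ∈ (A : Set Plane)
    · refine φ.contDiff.contDiffAt.congr_of_eventuallyEq ?_
      filter_upwards [A.isOpen.mem_nhds hx] with y hy using Set.indicator_of_mem hy _
    · exact contDiffAt_const.congr_of_eventuallyEq (notMem_tsupport_iff_eventuallyEq.1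
        fun h => hx (tsupport_indicator_subset hAB φ h))
  hasCompactSupport' := φ.hasCompactSupport.mono
    (by rw [Set.support_indicator]; exact Set.inter_subset_right)
  tsupport_subset' := tsupport_indicator_subset hAB φ

lemma restrictLeft_apply (hAB : Disjoint (A : Set Plane) B) (φ : 𝓓(A ⊔ B, ℝ)) {x : Plane}
    (hx : x ∈ (A : Set Plane)) : φ.restrictLeft hAB x = φ x :=
  Set.indicator_of_mem hx _

lemma gradient_restrictLeft (hAB : Disjoint (A : Set Plane) B) (φ : 𝓓(A ⊔ B, ℝ)) {x : Plane}
    (hx : x ∈ (A : Set Plane)) :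
    gradient (φ.restrictLeft hAB : Plane → ℝ) x = gradient (φ : Plane → ℝ) x := by
  refine Filter.EventuallyEq.gradient_eq ?_
  filter_upwards [A.isOpen.mem_nhds hx] with y hy using restrictLeft_apply hAB φ hy

end TestFunction

variable {A B : Opens Plane} {p q : ℝ} {u : Plane → ℝ} {g : Plane → Plane}

lemma IsWeakGradient.mono (h : A ≤ B) (hu : IsWeakGradient B u g) : IsWeakGradient A u g where
  locallyIntegrableOn_fun := hu.locallyIntegrableOn_fun.mono_set h
  locallyIntegrableOn_grad := hu.locallyIntegrableOn_grad.mono_set h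
  integral_eq φ i := by
    have := hu.integral_eq (φ.extend h) i
    simp only [TestFunction.coe_extend] at this
    rwa [setIntegral_eq_of_subset_of_forall_sdiff_eq_zero B.isOpen.measurableSet h,
      setIntegral_eq_of_subset_of_forall_sdiff_eq_zero B.isOpen.measurableSet h] at this
    · intro x hx
      rw [φ.apply_eq_zero_of_notMem hx.2, mul_zero]
    · intro x hx
      simp [φ.gradient_eq_zero_of_notMem hx.2]

lemma MemW1p.mono (h : A ≤ B) (hu : MemW1p B p u g) : MemW1p A p u g where
  memLp_fun := hu.memLp_fun.mono_measure (Measure.restrict_mono h le_rfl)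
  memLp_grad := hu.memLp_grad.mono_measure (Measure.restrict_mono h le_rfl)
  isWeakGradient := hu.isWeakGradient.mono h

/-- A function in `W_0^{1,p}` of a disjoint union restricts to `W_0^{1,p}` of each part. -/
lemma MemW01p.restrict_left (hAB : Disjoint (A : Set Plane) B) (hu : MemW01p (A ⊔ B) p u g) :
    MemW01p A p u g where
  memW1p := hu.memW1p.mono le_sup_left
  exists_approx := by
    obtain ⟨φ, hφ, hφ'⟩ := hu.exists_approx
    have hle : volume.restrict (A : Set Plane) ≤
        volume.restrict ((A ⊔ B : Opens Plane) : Set Plane) :=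
      Measure.restrict_mono (le_sup_left : A ≤ A ⊔ B) le_rfl
    refine ⟨fun n => (φ n).restrictLeft hAB,
      tendsto_of_tendsto_of_tendsto_of_le_of_le tendsto_const_nhds hφ (fun _ => zero_le) fun n => ?_,
      tendsto_of_tendsto_of_tendsto_of_le_of_le tendsto_const_nhds hφ' (fun _ => zero_le) fun n => ?_⟩
    · refine le_of_eq_of_le (eLpNorm_congr_ae ?_) (eLpNorm_mono_measure _ hle)
      refine ae_restrict_of_forall_mem A.isOpen.measurableSet fun x hx => ?_
      simp only [TestFunction.restrictLeft_apply hAB _ hx]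
    · refine le_of_eq_of_le (eLpNorm_congr_ae ?_) (eLpNorm_mono_measure _ hle)
      refine ae_restrict_of_forall_mem A.isOpen.measurableSet fun x hx => ?_
      simp only [TestFunction.gradient_restrictLeft hAB _ hx]

lemma restrict_restrict_sup_left (A B : Opens Plane) :
    (volume.restrict ((A ⊔ B : Opens Plane) : Set Plane)).restrict (A : Set Plane) =
      volume.restrict (A : Set Plane) := by
  rw [Measure.restrict_restrict_of_subset (le_sup_left : A ≤ A ⊔ B)]

lemma memLp_indicator_sup {E : Type*} [NormedAddCommGroup E] {f : Plane → E} {r : ℝ≥0∞}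
    (hf : MemLp f r (volume.restrict (A : Set Plane))) :
    MemLp ((A : Set Plane).indicator f) r
      (volume.restrict ((A ⊔ B : Opens Plane) : Set Plane)) := by
  rwa [memLp_indicator_iff_restrict A.isOpen.measurableSet, restrict_restrict_sup_left]

lemma setIntegral_indicator_sup (f : Plane → ℝ) :
    ∫ x in ((A ⊔ B : Opens Plane) : Set Plane), (A : Set Plane).indicator f x =
      ∫ x in (A : Set Plane), f x := by
  rw [integral_indicator A.isOpen.measurableSet, restrict_restrict_sup_left]

/-- Extension by zero maps `W^{1,p}(A)` to `W^{1,p}(A ∪ B)` if `A` and `B` are disjoint. -/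
lemma MemW1p.indicator_sup (hp : 1 ≤ p) (hAB : Disjoint (A : Set Plane) B)
    (hu : MemW1p A p u g) :
    MemW1p (A ⊔ B) p ((A : Set Plane).indicator u) ((A : Set Plane).indicator g) := by
  have hu' := memLp_indicator_sup (B := B) hu.memLp_fun
  have hg' := memLp_indicator_sup (B := B) hu.memLp_grad
  have hp' : 1 ≤ ENNReal.ofReal p := ENNReal.one_le_ofReal.2 hp
  refine ⟨hu', hg', locallyIntegrableOn_of_locallyIntegrable_restrict (hu'.locallyIntegrable hp'),
    locallyIntegrableOn_of_locallyIntegrable_restrict (hg'.locallyIntegrable hp'), fun φ i => ?_⟩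
  have h₁ : ∀ x, (A : Set Plane).indicator u x * (gradient (φ : Plane → ℝ) x) i =
      (A : Set Plane).indicator (fun x => u x * (gradient (φ : Plane → ℝ) x) i) x := fun x => by
    by_cases hx : x ∈ (A : Set Plane) <;> simp [hx]
  have h₂ : ∀ x, ((A : Set Plane).indicator g x) i * φ x =
      (A : Set Plane).indicator (fun x => (g x) i * φ x) x := fun x => by
    by_cases hx : x ∈ (A : Set Plane) <;> simp [hx]
  simp_rw [h₁, h₂, setIntegral_indicator_sup]
  -- Only the part of `φ` on `A` is seen, and that part is itself a test function on `A`.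
  convert hu.isWeakGradient.integral_eq (φ.restrictLeft hAB) i using 1
  · refine setIntegral_congr_fun A.isOpen.measurableSet fun x hx => ?_
    simp only [TestFunction.gradient_restrictLeft hAB _ hx]
  · refine congrArg _ (setIntegral_congr_fun A.isOpen.measurableSet fun x hx => ?_)
    simp only [TestFunction.restrictLeft_apply hAB _ hx]

/-- Extension by zero maps `W_0^{1,p}(A)` to `W_0^{1,p}(A ∪ B)` if `A` and `B` are disjoint. -/
lemma MemW01p.indicator_sup (hp : 1 ≤ p) (hAB : Disjoint (A : Set Plane) B)
    (hu : MemW01p A p u g) :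
    MemW01p (A ⊔ B) p ((A : Set Plane).indicator u) ((A : Set Plane).indicator g) where
  memW1p := hu.memW1p.indicator_sup hp hAB
  exists_approx := by
    obtain ⟨φ, hφ, hφ'⟩ := hu.exists_approx
    refine ⟨fun n => (φ n).extend le_sup_left, ?_, ?_⟩
    -- The approximants and their gradients vanish off `A`, so the norms over the union equal those
    -- over `A`.
    · convert hφ using 2 with n
      rw [← restrict_restrict_sup_left A B,
        ← eLpNorm_indicator_eq_eLpNorm_restrict A.isOpen.measurableSet]
      congr 1 with x
      by_cases hx : x ∈ (A : Set Plane)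
      · simp [hx, TestFunction.coe_extend]
      · simp [hx, TestFunction.coe_extend, (φ n).apply_eq_zero_of_notMem hx]
    · convert hφ' using 2 with n
      rw [← restrict_restrict_sup_left A B,
        ← eLpNorm_indicator_eq_eLpNorm_restrict A.isOpen.measurableSet]
      congr 1
      funext x
      by_cases hx : x ∈ (A : Set Plane)
      · simp [hx, TestFunction.coe_extend]
      · simp [hx, TestFunction.coe_extend, (φ n).gradient_eq_zero_of_notMem hx]

lemma setLIntegral_enorm_indicator_rpow_sup {E : Type*} [NormedAddCommGroup E] (f : Plane → E)
    {r : ℝ} (hr : 0 < r) :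
    ∫⁻ x in ((A ⊔ B : Opens Plane) : Set Plane), ‖(A : Set Plane).indicator f x‖ₑ ^ r =
      ∫⁻ x in (A : Set Plane), ‖f x‖ₑ ^ r := by
  rw [← restrict_restrict_sup_left A B, ← lintegral_indicator A.isOpen.measurableSet]
  refine lintegral_congr fun x => ?_
  by_cases hx : x ∈ (A : Set Plane) <;> simp [hx, hr]

lemma poincareSobolev_le_sup_left (hp : 1 ≤ p) (hq : 0 < q)
    (hAB : Disjoint (A : Set Plane) B) :
    poincareSobolev p q A ≤ poincareSobolev p q (A ⊔ B) := by
  refine iSup₂_le fun u g => iSup₂_le fun hu hne => ?_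
  have hne' : ¬ (A : Set Plane).indicator u
      =ᵐ[volume.restrict ((A ⊔ B : Opens Plane) : Set Plane)] 0 := by
    intro h
    refine hne ?_
    rw [← restrict_restrict_sup_left A B]
    filter_upwards [ae_restrict_of_ae h, ae_restrict_mem A.isOpen.measurableSet] with x hx hxA
    rwa [Set.indicator_of_mem hxA] at hx
  refine le_of_eq_of_le ?_
    (le_iSup₂_of_le _ _ (le_iSup₂_of_le (hu.indicator_sup hp hAB) hne' le_rfl))
  rw [setLIntegral_enorm_indicator_rpow_sup u hq,
    setLIntegral_enorm_indicator_rpow_sup g (zero_lt_one.trans_le hp)]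

/-- The supremum omits `u = 0`, yet a nonzero function on the union may vanish on one piece.
Finiteness of the constant rules out the product `⊤ * 0` when the gradient vanishes. -/
lemma MemW01p.lintegral_rpow_le_poincareSobolev_mul (hp : 0 < p) (hq : 0 < q)
    (hfin : poincareSobolev p q A ≠ ⊤) (hu : MemW01p A p u g) :
    (∫⁻ x in (A : Set Plane), ‖u x‖ₑ ^ q) ^ (p / q) ≤
      poincareSobolev p q A * ∫⁻ x in (A : Set Plane), ‖g x‖ₑ ^ p := by
  by_cases hne : u =ᵐ[volume.restrict (A : Set Plane)] 0
  · have : ∫⁻ x in (A : Set Plane), ‖u x‖ₑ ^ q = 0 := by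
      rw [lintegral_congr_ae (g := fun _ => 0) ?_, lintegral_zero]
      filter_upwards [hne] with x hx
      simp [hx, hq]
    rw [this, ENNReal.zero_rpow_of_pos (div_pos hp hq)]
    exact zero_le
  · have hg : ∫⁻ x in (A : Set Plane), ‖g x‖ₑ ^ p ≠ ⊤ := by
      have := lintegral_rpow_enorm_lt_top_of_eLpNorm_lt_top (p := ENNReal.ofReal p) (by simpa)
        ENNReal.ofReal_ne_top hu.memW1p.memLp_grad.2
      rw [ENNReal.toReal_ofReal hp.le] at this
      exact this.ne
    have hle : (∫⁻ x in (A : Set Plane), ‖u x‖ₑ ^ q) ^ (p / q) /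
        ∫⁻ x in (A : Set Plane), ‖g x‖ₑ ^ p ≤ poincareSobolev p q A :=
      le_iSup₂_of_le u g (le_iSup₂_of_le hu hne le_rfl)
    exact (ENNReal.div_le_iff_le_mul (.inr hfin) (.inl hg)).1 hle

lemma poincareSobolev_sup_le (hp : 0 < p) (hpq : p ≤ q) (hAB : Disjoint (A : Set Plane) B) :
    poincareSobolev p q (A ⊔ B) ≤ max (poincareSobolev p q A) (poincareSobolev p q B) := by
  set M := max (poincareSobolev p q A) (poincareSobolev p q B) with hM
  rcases eq_or_ne M ⊤ with htop | htop
  · rw [htop]; exact le_top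
  have hq : 0 < q := hp.trans_le hpq
  have hA : poincareSobolev p q A ≤ M := le_max_left _ _
  have hB : poincareSobolev p q B ≤ M := le_max_right _ _
  refine iSup₂_le fun u g => iSup₂_le fun hu _ => ENNReal.div_le_of_le_mul ?_
  have huA := hu.restrict_left hAB
  have huB : MemW01p B p u g := by
    rw [sup_comm] at hu
    exact hu.restrict_left hAB.symm
  rw [Opens.coe_sup, lintegral_union B.isOpen.measurableSet hAB,
    lintegral_union B.isOpen.measurableSet hAB, mul_add]
  -- Subadditivity of `t ↦ t^(p/q)`: the only place where `p ≤ q` is essential.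
  refine (ENNReal.rpow_add_le_add_rpow _ _ (div_pos hp hq).le ((div_le_one hq).2 hpq)).trans ?_
  gcongr ?_ + ?_
  · exact (huA.lintegral_rpow_le_poincareSobolev_mul hp hq
      (ne_top_of_le_ne_top htop hA)).trans (by gcongr)
  · exact (huB.lintegral_rpow_le_poincareSobolev_mul hp hq
      (ne_top_of_le_ne_top htop hB)).trans (by gcongr)

end

theorem lemma5p3 (Ω : Opens Plane) (hΩ_bounded : Bornology.IsBounded (Ω : Set Plane))
    (hΩ_connected : IsConnected (Ω : Set Plane)) (p q : ℝ) (hp : 1 < p) (hpq : p ≤ q)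
    (hq : ENNReal.ofReal q < sobolevConjugate p) (A₁ A₂ : Opens Plane) (hA₁ : A₁ ≤ Ω)
    (hA₂ : A₂ ≤ Ω) (hdisj : Disjoint (A₁ : Set Plane) (A₂ : Set Plane)) :
    poincareSobolev p q (A₁ ⊔ A₂) = max (poincareSobolev p q A₁) (poincareSobolev p q A₂) := by
  have hp₀ : 0 < p := zero_lt_one.trans hp
  refine le_antisymm (poincareSobolev_sup_le hp₀ hpq hdisj) (max_le ?_ ?_)
  · exact poincareSobolev_le_sup_left hp.le (hp₀.trans_le hpq) hdisj
  · rw [sup_comm]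
    exact poincareSobolev_le_sup_left hp.le (hp₀.trans_le hpq) hdisj.symm
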